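/- Let $\Sigma_0=\mathbb Z$ with generator $\sigma$, let $\Sigma_1=\mathbb Z/t_1\mathbb Z\oplus\dots\oplus\mathbb Z/t_s\mathbb Z$ with all $t_i\ge 2$, and let $\Sigma=\Sigma_0\oplus\Sigma_1$. For a subgroup $\Sigma'\subset\Sigma$: - a $\Sigma'$-ring is a commutative ring with an action of $\Sigma'$ by ring automorphisms; a $\Sigma'$-ideal is an ideal $I$ with $\tau(I)\subset I$ for all $\tau\in\Sigma'$; a $\Sigma'$-ring is $\Sigma'$-simple if it is nonzero and $(0)$ is its only proper $\Sigma'$-ideal; - a $\Sigma'$-pseudofield is a $\Sigma'$-simple ring that is absolutely flat (every module over it is flat); - $A\{y_1,\dots,y_n\}_{\Sigma'}$ is the polynomial ring over the $\Sigma'$-ring $A$ in the variables $\tau y_j$ ($\tau\in\Sigma'$, $1\le j\le n$), with $\Sigma'$ acting on the coefficients and by $\mu(\tau y_j)=(\mu\tau)y_j$; its elements are evaluated at points $a\in A^n$ by $\tau y_j\mapsto\tau(a_j)$; - a $\Sigma'$-pseudofield $A$ is $\Sigma'$-closed if for every $n$ and every $\Sigma'$-ideal $I$ of $A\{y_1,\dots,y_n\}_{\Sigma'}$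 the radical $\sqrt I$ is the ideal of all elements of $A\{y_1,\dots,y_n\}_{\Sigma'}$ that vanish at every common zero of $I$ in $A^n$. For a $\Sigma$-ring $A$ put $A^\sigma=\{a\in A : \sigma(a)=a\}$, which is a $\Sigma_1$-ring. **Theorem.** Let $L$ be a Noetherian $\Sigma$-pseudofield such that $C:=L^\sigma$ is a $\Sigma_1$-closed pseudofield. Let $R$ be a $\Sigma$-simple ring over $L$ (a $\Sigma$-ring with a ring homomorphism $L\to R$ that commutes with $\Sigma$) which is $\Sigma_1$-finitely generated over $L$, that is, generated as an $L$-algebra by the elements $\tau(a_j)$, $\tau\in\Sigma_1$, for finitely many $a_1,\dots,a_m\in R$. Then $$R^\sigma = C,$$ where $C$ is identified with its image in $R$. -/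

import Mathlib

universe u v

namespace DifferenceAlgebra

section General

variable (G : Type*) [Group G] (R : Type u) [CommRing R] [MulSemiringAction G R]

/-- Every `R`-module is flat. -/
def IsAbsolutelyFlat (R : Type u) [CommRing R] : Prop :=
  ∀ (M : Type u) [AddCommGroup M] [Module R M], Module.Flat R M

variable {R} in
/-- A `G`-ideal: an ideal `I` with `g (I) ⊆ I` for every `g` in `G`. -/
def IsDifferenceIdeal (I : Ideal R) : Prop :=
  ∀ g : G, ∀ a ∈ I, g • a ∈ I

/-- A `G`-simple ring: a nonzero ring whose only proper `G`-ideal is zero. -/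
def IsDifferenceSimple : Prop :=
  Nontrivial R ∧ ∀ I : Ideal R, IsDifferenceIdeal G I → I = ⊥ ∨ I = ⊤

/-- A `G`-pseudofield: an absolutely flat `G`-simple ring. -/
def IsPseudofield : Prop :=
  IsAbsolutelyFlat R ∧ IsDifferenceSimple G R

/-- The ring `R{Y}` of `G`-polynomials over `R` with `G`-indeterminates in `Y`; the polynomial
variable with index `(g, y)` is `g y`. -/
def DifferencePolynomial (Y : Type*) : Type _ :=
  MvPolynomial (G × Y) R

namespace DifferencePolynomial

variable (Y : Type*)

noncomputable instance : CommRing (DifferencePolynomial G R Y) :=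
  inferInstanceAs (CommRing (MvPolynomial (G × Y) R))

variable {G R Y}

/-- The map `p ↦ g p` on polynomials in the variables `h y`: it acts on the coefficients through
the action of `g` on `R`, and sends the variable `h y` to `(g h) y`. -/
noncomputable def actHom (g : G) : MvPolynomial (G × Y) R →+* MvPolynomial (G × Y) R :=
  MvPolynomial.eval₂Hom (MvPolynomial.C.comp (MulSemiringAction.toRingHom G R g))
    (fun i => MvPolynomial.X (g * i.1, i.2))

theorem actHom_one : actHom (1 : G) = RingHom.id (MvPolynomial (G × Y) R) := by
  apply MvPolynomial.ringHom_ext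
  · intro r
    simp [actHom]
  · intro i
    simp [actHom]

theorem actHom_mul (g h : G) :
    (actHom (g * h) : MvPolynomial (G × Y) R →+* _) = (actHom g).comp (actHom h) := by
  apply MvPolynomial.ringHom_ext
  · intro r
    simp [actHom, mul_smul]
  · intro i
    simp [actHom, mul_assoc]

/-- The action of `g` on `R{Y}`. -/
noncomputable def act (g : G) : DifferencePolynomial G R Y →+* DifferencePolynomial G R Y :=
  (actHom g : MvPolynomial (G × Y) R →+* MvPolynomial (G × Y) R)

theorem act_one (p : DifferencePolynomial G R Y) : act 1 p = p :=
  congrArg (fun f : MvPolynomial (G × Y) R →+* MvPolynomial (G × Y) R => f p) actHom_one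

theorem act_mul (g h : G) (p : DifferencePolynomial G R Y) :
    act (g * h) p = act g (act h p) :=
  congrArg (fun f : MvPolynomial (G × Y) R →+* MvPolynomial (G × Y) R => f p) (actHom_mul g h)

noncomputable instance : MulSemiringAction G (DifferencePolynomial G R Y) where
  smul g p := act g p
  one_smul := act_one
  mul_smul := act_mul
  smul_zero g := map_zero (act g)
  smul_add g := map_add (act g)
  smul_one g := map_one (act g)
  smul_mul g := map_mul (act g)

/-- The value of a `G`-polynomial at a point `a`: the variable `g y` takes the value `g (a y)`. -/
noncomputable def evalAt (a : Y → R) : DifferencePolynomial G R Y →+* R :=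
  (MvPolynomial.eval (fun i : G × Y => i.1 • a i.2) : MvPolynomial (G × Y) R →+* R)

/-- The set of common zeros of `E` with coordinates in `R`. -/
def zeroLocus (E : Set (DifferencePolynomial G R Y)) : Set (Y → R) :=
  {a | ∀ p ∈ E, evalAt a p = 0}

/-- The ideal of all `G`-polynomials that vanish on `X`. -/
def vanishingIdeal (X : Set (Y → R)) : Ideal (DifferencePolynomial G R Y) where
  carrier := {p | ∀ a ∈ X, evalAt a p = 0}
  zero_mem' a _ := map_zero (evalAt a)
  add_mem' {p q} hp hq a ha := by rw [map_add, hp a ha, hq a ha, add_zero]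
  smul_mem' p q hq a ha := by rw [smul_eq_mul, map_mul, hq a ha, mul_zero]

end DifferencePolynomial

/-- A difference closed `G`-pseudofield: for every `G`-ideal `I` of a ring of `G`-polynomials over
`R` in finitely many `G`-indeterminates, `√I` is the ideal of all `G`-polynomials vanishing on the
zeros of `I` in `R`. -/
def IsClosedPseudofield : Prop :=
  IsPseudofield G R ∧
    ∀ (n : ℕ) (I : Ideal (DifferencePolynomial G R (Fin n))), IsDifferenceIdeal G I →
      I.radical = DifferencePolynomial.vanishingIdeal
        (DifferencePolynomial.zeroLocus (I : Set (DifferencePolynomial G R (Fin n))))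

/-- `S` is generated as an algebra over `A` by the `G`-orbits of finitely many elements. -/
def IsDifferenceFinitelyGenerated (A : Type*) [CommRing A] (S : Type*) [CommRing S]
    [MulSemiringAction G S] [Algebra A S] : Prop :=
  ∃ F : Finset S, Algebra.adjoin A {x : S | ∃ g : G, ∃ a ∈ F, x = g • a} = ⊤

end General

/-- If `G` is commutative, the constants of a subgroup `H` are stable under a subgroup `K`,
so that `K` acts on them. -/
instance {G : Type*} [CommGroup G] (H K : Subgroup G) (R : Type u) [CommRing R]
    [MulSemiringAction G R] : IsInvariantSubring K (FixedPoints.subring R H) where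
  smul_mem := by
    intro k x hx h
    have hx' : ∀ m : H, m • x = x := hx
    calc h • k • x = (h : G) • (k : G) • x := rfl
      _ = (k : G) • (h : G) • x := smul_comm _ _ _
      _ = k • x := congrArg (fun y => (k : G) • y) (hx' h)

/-- The group `Σ = ℤ ⊕ ℤ/t₁ ⊕ ⋯ ⊕ ℤ/tₛ`, written multiplicatively. -/
abbrev Sig {s : ℕ} (t : Fin s → ℕ) : Type :=
  Multiplicative (ℤ × ((i : Fin s) → ZMod (t i)))

/-- The subgroup `Σ₀ = ℤ` of `Σ`, generated by `σ = (1, 0)`. -/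
def Sig0 {s : ℕ} (t : Fin s → ℕ) : Subgroup (Sig t) :=
  Subgroup.zpowers (Multiplicative.ofAdd (1, 0))

/-- The finite subgroup `Σ₁ = ℤ/t₁ ⊕ ⋯ ⊕ ℤ/tₛ` of `Σ`. -/
def Sig1 {s : ℕ} (t : Fin s → ℕ) : Subgroup (Sig t) :=
  AddSubgroup.toSubgroup (AddSubgroup.prod ⊥ ⊤)

/-- The subring `R^σ` of elements fixed by `σ`, equivalently by all of `Σ₀`. -/
abbrev SigmaConstants {s : ℕ} (t : Fin s → ℕ) (R : Type u) [CommRing R]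
    [MulSemiringAction (Sig t) R] : Subring R :=
  FixedPoints.subring R (Sig0 t)

end DifferenceAlgebra

open DifferenceAlgebra

/-!
Write `C = L^σ`, let `c ∈ R^σ`, and let `B = C{c}` be the subring of `R` generated over `C` by the
finite orbit `Σ₁ c`. If some `a ∈ C` is such that the elements `τ (c - a)`, `τ ∈ Σ₁`, generate a
proper ideal of `R`, then this ideal is a `Σ`-ideal because `σ` fixes `c` and `a`, so it is zero as
`R` is `Σ`-simple, and `c = a`.

To find `a`, let `I` be the ideal of all `Σ₁`-equations over `C` satisfied by `c`, so that
`B = C{y} / I`, and let `V` be the set of zeros of `I` in `C`. The ideal `I` is radical because `R` is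
reduced, and `C` is `Σ₁`-closed, so `I` is the ideal of `V`; that is, `B` embeds into the power
`V → C`. Now `B` consists of `σ`-constants both in `R` and in the power `V → L`, and `L` is linearly
disjoint over `C` from the constants of any `σ`-ring over `L` (`injective_of_invariant`, which rests
on the shortest-relation argument `eq_zero_of_mem_stable_submodule`). Hence `L ⊗[C] B` embeds into
both `R` and `V → L`. By Chevalley's theorem (`exists_forall_prime_eq_comap`) the image of `Spec R` in
`Spec (L ⊗[C] B)` contains a nonempty open set `D(f)`. The image of `f` in `V → L` is nonzero, so
there are a point `a ∈ V` and a prime ideal of `L` avoiding `f(a)`; its preimage under evaluation at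
`a` lies in `D(f)`, hence comes from a prime ideal of `R`, and this prime contains every `τ (c - a)`
(`exists_prime_of_injective`).
-/

open scoped TensorProduct

namespace DifferenceAlgebra

/-! ### Linear disjointness over the constants -/

/-- In an absolutely flat Noetherian ring every ideal is generated by an idempotent, and this idempotent
is unique; hence a stable ideal has an invariant generator. -/
theorem exists_invariant_generator {L : Type u} [CommRing L] [IsNoetherianRing L]
    (hL : IsAbsolutelyFlat L) {H : Type*} [Group H] [MulSemiringAction H L]
    (I : Ideal L) (hI : IsDifferenceIdeal H I) :
    ∃ e ∈ I, (∀ h : H, h • e = e) ∧ ∀ x ∈ I, x * e = x := by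
  have : I.Pure := hL (L ⧸ I)
  obtain ⟨e, he, hIe⟩ := (Ideal.isIdempotentElem_iff_of_fg I (IsNoetherian.noetherian I)).1
    I.isIdempotentElem_of_pure
  have heI : e ∈ I := hIe ▸ Ideal.mem_span_singleton_self e
  have hmul : ∀ x ∈ I, x * e = x := by
    intro x hx
    rw [hIe] at hx
    obtain ⟨y, rfl⟩ := Ideal.mem_span_singleton'.1 hx
    rw [mul_assoc, he.eq]
  refine ⟨e, heI, fun h => ?_, hmul⟩
  have h1 := hmul _ (hI h e heI)
  have h2 := congrArg (h • ·) (hmul _ (hI h⁻¹ e heI))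
  simp only [smul_mul', smul_inv_smul] at h2
  rw [← h1, mul_comm, h2]

/-- Descent: let `M` be an `L`-module with semilinear operators `φ h`, spanned by a set `X` of fixed
vectors. A stable submodule `J` without nonzero fixed vectors vanishes. The proof is the
shortest-relation argument, by induction on a finite subset of `X` that supports an element of `J`.
As `L` need not be a field, the leading coefficient of a relation is normalized not to `1` but to an
invariant idempotent that generates the ideal of all possible leading coefficients. -/
theorem eq_zero_of_mem_stable_submodule {L : Type u} [CommRing L] [IsNoetherianRing L]
    (hL : IsAbsolutelyFlat L) {H : Type*} [Group H] [MulSemiringAction H L]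
    {M : Type*} [AddCommGroup M] [Module L M] (φ : H → M →+ M)
    (hφ : ∀ (h : H) (l : L) (m : M), φ h (l • m) = (h • l) • φ h m)
    {X : Set M} (hX : ∀ x ∈ X, ∀ h, φ h x = x) (hspan : Submodule.span L X = ⊤)
    (J : Submodule L M) (hJ : ∀ h, ∀ x ∈ J, φ h x ∈ J)
    (hfix : ∀ x ∈ J, (∀ h, φ h x = x) → x = 0) {x : M} (hx : x ∈ J) : x = 0 := by
  have key : ∀ s : Finset M, (s : Set M) ⊆ X → ∀ x ∈ J, x ∈ Submodule.span L (s : Set M) →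
      x = 0 := by
    classical
    intro s
    induction s using Finset.induction_on with
    | empty => intro _ x _ hx; simpa using hx
    | insert b s _ ih =>
      intro hs x hx hxs
      rw [Finset.coe_insert, Set.insert_subset_iff] at hs
      rw [Finset.coe_insert] at hxs
      specialize ih hs.2
      have hstab : ∀ h, ∀ z ∈ Submodule.span L (s : Set M),
          φ h z ∈ Submodule.span L (s : Set M) := by
        intro h z hz
        induction hz using Submodule.span_induction with
        | mem y hy => rw [hX y (hs.2 hy)]; exact Submodule.subset_span hy
        | zero => rw [map_zero]; exact zero_mem _
        | add y z _ _ hy hz => rw [map_add]; exact add_mem hy hz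
        | smul l y _ hy => rw [hφ]; exact Submodule.smul_mem _ _ hy
      -- The ideal of coefficients at `b` of the elements of `J` supported on `b` and `s`.
      let I : Ideal L := (J ⊔ Submodule.span L (s : Set M)).comap (LinearMap.toSpanSingleton L M b)
      have hI : ∀ l, l ∈ I ↔ ∃ z ∈ Submodule.span L (s : Set M), l • b + z ∈ J := by
        intro l
        simp only [I, Submodule.mem_comap, LinearMap.toSpanSingleton_apply, Submodule.mem_sup]
        constructor
        · rintro ⟨y, hy, z, hz, hyz⟩
          exact ⟨-z, neg_mem hz, by rw [← hyz]; simpa using hy⟩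
        · rintro ⟨z, hz, hJz⟩
          exact ⟨_, hJz, -z, neg_mem hz, by abel⟩
      obtain ⟨e, heI, hefix, hemul⟩ := exists_invariant_generator hL (H := H) I (by
        intro h l hl
        obtain ⟨z, hz, hJz⟩ := (hI l).1 hl
        refine (hI _).2 ⟨φ h z, hstab h z hz, ?_⟩
        have := hJ h _ hJz
        rwa [map_add, hφ, hX b hs.1] at this)
      obtain ⟨z, hz, hJz⟩ := (hI e).1 heI
      -- `h` moves this element only by something supported on `s`, so it is fixed.
      have h0 : e • b + z = 0 := by
        refine hfix _ hJz fun h => sub_eq_zero.1 (ih _ (sub_mem (hJ h _ hJz) hJz) ?_)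
        rw [map_add, hφ, hX b hs.1, hefix, add_sub_add_left_eq_sub]
        exact sub_mem (hstab h z hz) hz
      obtain ⟨l, w, hw, rfl⟩ := Submodule.mem_span_insert.1 hxs
      refine ih _ hx ?_
      have hl : l * e = l := hemul l ((hI l).2 ⟨w, hw, hx⟩)
      have : l • b + w = w - l • z := by
        rw [eq_neg_of_add_eq_zero_right h0, smul_neg, smul_smul, hl]; abel
      rw [this]
      exact sub_mem hw (Submodule.smul_mem _ _ hz)
  have hxX : x ∈ Submodule.span L X := hspan ▸ Submodule.mem_top
  obtain ⟨s, hs, hxs⟩ := Submodule.mem_span_finite_of_mem_span hxX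
  exact key s hs x hx hxs

/-- Linear disjointness over the constants `C` of a cyclic group `H` acting on `L`: an equivariant
`L`-linear map on `L ⊗ B`, where `H` acts trivially on the flat `C`-module `B`, is injective as soon
as it is injective on `B`. The target needs only additive operators `T h`, semilinear over `L`. -/
theorem injective_of_invariant {L : Type u} [CommRing L] [IsNoetherianRing L]
    (hL : IsAbsolutelyFlat L) {H : Type*} [Group H] [MulSemiringAction H L]
    {σ : H} (hσ : ∀ h, h ∈ Subgroup.zpowers σ)
    {C : Type*} [CommRing C] [Algebra C L]
    (hC : ∀ l : L, (∀ h : H, h • l = l) ↔ l ∈ Set.range (algebraMap C L))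
    (B : Type*) [AddCommGroup B] [Module C B] [Module.Flat C B]
    {S : Type*} [AddCommGroup S] [Module L S] (T : H → S →+ S)
    (hT : ∀ (h : H) (l : L) (m : S), T h (l • m) = (h • l) • T h m)
    (F : L ⊗[C] B →ₗ[L] S)
    (hfix : ∀ h b, T h (F (1 ⊗ₜ b)) = F (1 ⊗ₜ b))
    (hinj : ∀ b, F (1 ⊗ₜ b) = 0 → b = 0) : Function.Injective F := by
  let act : H → L →ₗ[C] L := fun h =>
    { toFun := fun l => h • l
      map_add' := smul_add h
      map_smul' := fun c l => by
        rw [Algebra.smul_def, smul_mul', (hC _).2 ⟨c, rfl⟩ h, ← Algebra.smul_def]; rfl }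
  let φ : H → L ⊗[C] B →+ L ⊗[C] B := fun h => ((act h).rTensor B).toAddMonoidHom
  have hφ_tmul : ∀ h l b, φ h (l ⊗ₜ b) = (h • l) ⊗ₜ b := fun h l b => rfl
  have hφ : ∀ (h : H) (l : L) (m : L ⊗[C] B), φ h (l • m) = (h • l) • φ h m := by
    intro h l m
    induction m with
    | zero => simp
    | tmul x b =>
      rw [TensorProduct.smul_tmul', hφ_tmul, hφ_tmul, TensorProduct.smul_tmul']
      simp [smul_mul']
    | add x y hx hy => simp only [smul_add, map_add, hx, hy]
  have hTF : ∀ h x, T h (F x) = F (φ h x) := by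
    intro h x
    induction x with
    | zero => simp
    | tmul l b =>
      have h1 : ∀ r : L, r ⊗ₜ[C] b = r • (1 ⊗ₜ[C] b) := fun r => by
        rw [TensorProduct.smul_tmul', smul_eq_mul, mul_one]
      rw [hφ_tmul, h1 l, h1 (h • l), F.map_smul, F.map_smul, hT, hfix]
    | add x y hx hy => simp only [map_add, hx, hy]
  -- Flatness of `B` over `C` keeps the sequence `C → L → L` with second map `σ - 1` exact.
  have hexact : Function.Exact (Algebra.linearMap C L) (act σ - LinearMap.id : L →ₗ[C] L) := by
    intro l
    have hσl : (act σ - LinearMap.id : L →ₗ[C] L) l = 0 ↔ σ • l = l := by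
      change σ • l - l = 0 ↔ _
      rw [sub_eq_zero]
    rw [hσl]
    constructor
    · intro hl
      have hst : Subgroup.zpowers σ ≤ MulAction.stabilizer H l := by
        rw [Subgroup.zpowers_le]; exact hl
      exact (hC l).1 fun h => hst (hσ h)
    · exact fun hl => (hC l).2 hl σ
  have hlid : ∀ y : C ⊗[C] B,
      (Algebra.linearMap C L).rTensor B y = 1 ⊗ₜ TensorProduct.lid C B y := by
    intro y
    induction y with
    | zero => simp
    | tmul c b =>
      rw [LinearMap.rTensor_tmul, TensorProduct.lid_tmul, ← TensorProduct.smul_tmul,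
        Algebra.linearMap_apply, Algebra.algebraMap_eq_smul_one]
    | add x y hx hy => rw [map_add, map_add, hx, hy, TensorProduct.tmul_add]
  have hfixed : ∀ x : L ⊗[C] B, (∀ h, φ h x = x) → ∃ b, x = 1 ⊗ₜ b := by
    intro x hx
    have h0 : (act σ - LinearMap.id : L →ₗ[C] L).rTensor B x = 0 := by
      rw [LinearMap.rTensor_sub, LinearMap.sub_apply, LinearMap.rTensor_id, sub_eq_zero]
      exact hx σ
    obtain ⟨y, rfl⟩ := ((Module.Flat.rTensor_exact (M := B) hexact) x).1 h0
    exact ⟨_, hlid y⟩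
  rw [← LinearMap.ker_eq_bot, Submodule.eq_bot_iff]
  intro x hx
  refine eq_zero_of_mem_stable_submodule hL φ hφ (X := Set.range fun b : B => (1 : L) ⊗ₜ[C] b)
    ?_ ?_ (LinearMap.ker F) ?_ ?_ hx
  · rintro _ ⟨b, rfl⟩ h
    rw [hφ_tmul, smul_one]
  · rw [eq_top_iff]
    rintro y -
    induction y with
    | zero => exact zero_mem _
    | tmul l b =>
      have : l ⊗ₜ[C] b = l • (1 ⊗ₜ[C] b) := by
        rw [TensorProduct.smul_tmul', smul_eq_mul, mul_one]
      rw [this]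
      exact Submodule.smul_mem _ _ (Submodule.subset_span ⟨b, rfl⟩)
    | add x y hx hy => exact add_mem hx hy
  · intro h y hy
    rw [LinearMap.mem_ker] at hy ⊢
    rw [← hTF, hy, map_zero]
  · intro y hy hyfix
    obtain ⟨b, rfl⟩ := hfixed y hyfix
    rw [hinj b hy, TensorProduct.tmul_zero]

/-! ### Specialization -/

/-- A consequence of Chevalley's theorem: the image of `Spec S → Spec A` contains a nonempty basic open
set `D(a)`, because it is constructible and contains the minimal primes. -/
theorem exists_forall_prime_eq_comap {A : Type*} {S : Type*} [CommRing A] [CommRing S]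
    [IsNoetherianRing A] [Nontrivial A] (f : A →+* S) (hf : f.FiniteType)
    (hinj : Function.Injective f) :
    ∃ a : A, a ≠ 0 ∧ ∀ q : Ideal A, q.IsPrime → a ∉ q →
      ∃ r : Ideal S, r.IsPrime ∧ r.comap f = q := by
  classical
  obtain ⟨D, hD⟩ := PrimeSpectrum.exists_constructibleSetData_iff.2
    (PrimeSpectrum.isConstructible_range_comap (RingHom.FinitePresentation.of_finiteType.1 hf))
  -- A minimal prime `p` is in the image, hence in one of the locally closed pieces `Z` of the image.
  -- Near `p` the spectrum is the closure of `p`, so that `Z` is a neighbourhood of `p`.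
  obtain ⟨p, hp⟩ : (minimalPrimes A).Nonempty := by
    obtain ⟨m, hm⟩ := Ideal.exists_maximal A
    obtain ⟨p, hp, -⟩ := Ideal.exists_minimalPrimes_le (I := ⊥) (J := m) bot_le
    exact ⟨p, hp⟩
  have hpp : p.IsPrime := hp.1.1
  obtain ⟨p', hp', hpc⟩ := Ideal.exists_comap_eq_of_mem_minimalPrimes_of_injective hinj p hp
  have hpmem : (⟨p, hpp⟩ : PrimeSpectrum A) ∈ D.toSet := by
    rw [hD]; exact ⟨⟨p', hp'⟩, PrimeSpectrum.ext hpc⟩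
  simp only [PrimeSpectrum.ConstructibleSetData.toSet, Set.mem_iUnion] at hpmem
  obtain ⟨Z, hZD, hpZ⟩ := hpmem
  simp only [PrimeSpectrum.BasicConstructibleSetData.toSet, Set.mem_sdiff,
    PrimeSpectrum.mem_zeroLocus, Set.singleton_subset_iff, SetLike.mem_coe] at hpZ
  -- An element outside `p` that lies in every other minimal prime.
  obtain ⟨b, hbp, hb⟩ : ∃ b ∉ p, ∀ q ∈ minimalPrimes A, q ≠ p → b ∈ q := by
    have hfin := minimalPrimes.finite_of_isNoetherianRing A
    let E := hfin.toFinset.erase p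
    have hE : ¬ E.inf id ≤ p := by
      rw [Ideal.IsPrime.inf_le' hpp]
      rintro ⟨q, hq, hqp⟩
      simp only [E, Finset.mem_erase, Set.Finite.mem_toFinset] at hq
      exact hq.1 (le_antisymm hqp (hp.2 hq.2.1 hqp))
    obtain ⟨b, hb, hbp⟩ := SetLike.not_le_iff_exists.1 hE
    refine ⟨b, hbp, fun q hq hqp => ?_⟩
    have : E.inf id ≤ q := Finset.inf_le (f := id) (by simp [E, hq, hqp])
    exact this hb
  refine ⟨Z.f * b, fun h0 => ?_, fun q hq hqn => ?_⟩
  · rcases hpp.mem_or_mem (h0 ▸ p.zero_mem : Z.f * b ∈ p) with h | h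
    exacts [hpZ.2 h, hbp h]
  · have hpq : p ≤ q := by
      obtain ⟨p₁, hp₁, hp₁q⟩ := Ideal.exists_minimalPrimes_le (I := ⊥) (J := q) bot_le
      by_cases h : p₁ = p
      · exact h ▸ hp₁q
      · exact (hqn (q.mul_mem_left _ (hp₁q (hb p₁ hp₁ h)))).elim
    have hqmem : (⟨q, hq⟩ : PrimeSpectrum A) ∈ D.toSet := by
      simp only [PrimeSpectrum.ConstructibleSetData.toSet, Set.mem_iUnion]
      refine ⟨Z, hZD, ?_⟩
      simp only [PrimeSpectrum.BasicConstructibleSetData.toSet, Set.mem_sdiff,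
        PrimeSpectrum.mem_zeroLocus, Set.singleton_subset_iff, SetLike.mem_coe]
      exact ⟨hpZ.1.trans hpq, fun h => hqn (q.mul_mem_right _ h)⟩
    rw [hD] at hqmem
    obtain ⟨r, hr⟩ := hqmem
    exact ⟨r.asIdeal, r.2, congrArg PrimeSpectrum.asIdeal hr⟩

/-! ### Descent of constants -/

theorem isReduced_of_isAbsolutelyFlat {L : Type u} [CommRing L] (hL : IsAbsolutelyFlat L) :
    IsReduced L := by
  refine (isReduced_iff_pow_one_lt 2 one_lt_two).2 fun x hx => ?_
  have : (Ideal.span {x}).Pure := hL _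
  have h := (Ideal.span {x}).isIdempotentElem_of_pure
  rw [IsIdempotentElem, Ideal.span_singleton_mul_span_singleton, ← sq, hx] at h
  exact Ideal.span_singleton_eq_bot.1 (h.symm.trans (Ideal.span_singleton_eq_bot.2 rfl))

theorem isReduced_of_isDifferenceSimple {G : Type*} [Group G] {R : Type v} [CommRing R]
    [MulSemiringAction G R] (hR : IsDifferenceSimple G R) : IsReduced R := by
  have := hR.1
  rw [← nilradical_eq_bot_iff]
  refine (hR.2 (nilradical R) fun g a ha => ?_).resolve_right fun h => ?_
  · exact (mem_nilradical.1 ha).map (MulSemiringAction.toRingHom G R g)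
  · have h1 : (1 : R) ∈ nilradical R := h ▸ Submodule.mem_top
    exact not_isNilpotent_one h1

open MvPolynomial in
/-- Evaluation of difference polynomials at a point is equivariant. -/
theorem aeval_smul_actHom {G : Type*} [Group G] (K : Subgroup G) {C : Type u} [CommRing C]
    [MulSemiringAction K C] {R : Type v} [CommRing R] [MulSemiringAction G R] [Algebra C R]
    (hCR : ∀ (k : K) (c : C), algebraMap C R (k • c) = (k : G) • algebraMap C R c)
    {Y : Type*} (c : Y → R) (k : K) (p : MvPolynomial (K × Y) C) :
    aeval (fun i : K × Y => (i.1 : G) • c i.2) (DifferencePolynomial.actHom k p) =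
      (k : G) • aeval (fun i : K × Y => (i.1 : G) • c i.2) p := by
  induction p using MvPolynomial.induction_on with
  | C a => simp [DifferencePolynomial.actHom, hCR]
  | add p q hp hq => simp only [map_add, smul_add, hp, hq]
  | mul_X p i hp =>
    simp only [map_mul, smul_mul', hp]
    simp [DifferencePolynomial.actHom, mul_smul]

/-- If `L ⊗ B` embeds both into a finitely generated `L`-algebra `R` and, through a family of
`L`-points `E · a`, into a power of `L`, then for some `a` the kernel of `E · a` generates a proper
ideal of `R`: the points are dense in `Spec (L ⊗ B)`, and the image of `Spec R` contains a nonempty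
open set. -/
theorem exists_prime_of_injective {L C B R V : Type*} [CommRing L] [IsNoetherianRing L]
    [IsReduced L] [CommRing C] [Algebra C L] [CommRing B] [Algebra C B] [Algebra.FiniteType C B]
    [CommRing R] [Nontrivial R] [Algebra L R] [Algebra.FiniteType L R]
    (F : L ⊗[C] B →ₐ[L] R) (hF : Function.Injective F)
    (E : L ⊗[C] B →ₐ[L] (V → L)) (hE : Function.Injective E) :
    ∃ (a : V) (r : Ideal R), r.IsPrime ∧ ∀ x, E x a = 0 → F x ∈ r := by
  have : IsNoetherianRing (L ⊗[C] B) := Algebra.FiniteType.isNoetherianRing L (L ⊗[C] B)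
  have : Nontrivial (L ⊗[C] B) := (F : L ⊗[C] B →+* R).domain_nontrivial
  have hFft : (F : L ⊗[C] B →+* R).FiniteType := by
    refine RingHom.FiniteType.of_comp_finiteType (f := algebraMap L (L ⊗[C] B)) ?_
    rw [AlgHom.comp_algebraMap]
    exact RingHom.finiteType_algebraMap.2 inferInstance
  obtain ⟨f, hf0, hf⟩ := exists_forall_prime_eq_comap (F : L ⊗[C] B →+* R) hFft hF
  obtain ⟨a, ha⟩ : ∃ a : V, E f a ≠ 0 := by
    by_contra! h
    exact hf0 (hE ((funext h).trans (map_zero E).symm))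
  -- Since `L` is reduced, some prime ideal of `L` avoids the nonzero element `E f a`.
  obtain ⟨p, hp, hfp⟩ : ∃ p : Ideal L, p.IsPrime ∧ E f a ∉ p := by
    by_contra! h
    exact ha (IsNilpotent.eq_zero (nilpotent_iff_mem_prime.2 h))
  let ε : L ⊗[C] B →+* L := (Pi.evalRingHom (fun _ : V => L) a).comp (E : L ⊗[C] B →+* V → L)
  obtain ⟨r, hr, hrp⟩ := hf (p.comap ε) (hp.comap ε) hfp
  refine ⟨a, r, hr, fun x hx => ?_⟩
  change x ∈ r.comap (F : L ⊗[C] B →+* R)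
  rw [hrp, Ideal.mem_comap]
  exact (congrArg (· ∈ p) hx).mpr p.zero_mem

/-- The descent of constants for a commutative group generated by a cyclic subgroup `H` and a finite
subgroup `K`. The ring `C` of `H`-constants of `L` enters as an abstract ring with an embedding into
`L`. -/
theorem mem_range_of_invariant {G : Type} [CommGroup G] (H K : Subgroup G) [Finite K]
    (hHK : ∀ g : G, ∃ h ∈ H, ∃ k ∈ K, g = h * k) {σ : H} (hσ : ∀ h, h ∈ Subgroup.zpowers σ)
    {L : Type u} [CommRing L] [MulSemiringAction G L] [IsNoetherianRing L]
    (hL : IsAbsolutelyFlat L)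
    {C : Type u} [CommRing C] [MulSemiringAction K C] [Algebra C L]
    (hinj : Function.Injective (algebraMap C L))
    (hCK : ∀ (k : K) (c : C), algebraMap C L (k • c) = (k : G) • algebraMap C L c)
    (hCH : ∀ l : L, (∀ h : H, h • l = l) ↔ l ∈ Set.range (algebraMap C L))
    (hC : IsClosedPseudofield K C)
    {R : Type v} [CommRing R] [MulSemiringAction G R] [Algebra L R] [Algebra C R]
    [IsScalarTower C L R] (hLR : ∀ (g : G) (l : L), algebraMap L R (g • l) = g • algebraMap L R l)
    [Algebra.FiniteType L R] (hR : IsDifferenceSimple G R)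
    {c : R} (hc : ∀ h : H, h • c = c) :
    ∃ a : C, algebraMap C R a = c := by
  have : IsReduced R := isReduced_of_isDifferenceSimple hR
  have : IsReduced L := isReduced_of_isAbsolutelyFlat hL
  have := hR.1
  have hCKR : ∀ (k : K) (c : C), algebraMap C R (k • c) = (k : G) • algebraMap C R c := by
    intro k c
    rw [IsScalarTower.algebraMap_apply C L R, hCK, hLR, ← IsScalarTower.algebraMap_apply]
  have hCHR : ∀ (h : H) (c : C), h • algebraMap C R c = algebraMap C R c := by
    intro h c
    rw [IsScalarTower.algebraMap_apply C L R]
    exact (hLR h _).symm.trans (congrArg _ ((hCH _).2 ⟨c, rfl⟩ h))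
  let P := MvPolynomial (K × Fin 1) C
  let θ : P →ₐ[C] R := MvPolynomial.aeval fun i => (i.1 : G) • c
  let I : Ideal P := RingHom.ker θ
  have hI : @IsDifferenceIdeal K _ (DifferencePolynomial K C (Fin 1)) _ _ I := by
    intro k p hp
    change θ (DifferencePolynomial.actHom k p) = 0
    rw [aeval_smul_actHom K hCKR (fun _ : Fin 1 => c) k p]
    exact (congrArg _ hp).trans (smul_zero _)
  -- `V` consists of the zeros in `C` of all difference equations satisfied by `c`.
  let V : Set (Fin 1 → C) := DifferencePolynomial.zeroLocus (G := K) (I : Set P)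
  let ev : V → P →ₐ[C] L := fun a => MvPolynomial.aeval fun i => algebraMap C L (i.1 • a.1 i.2)
  have hev : ∀ a p, ev a p = algebraMap C L (DifferencePolynomial.evalAt (G := K) a.1 p) := by
    intro a p
    exact MvPolynomial.aeval_algebraMap_apply L (fun i : K × Fin 1 => i.1 • a.1 i.2) p
  have hVI : ∀ p : P, (∀ a : V, ev a p = 0) → p ∈ I := by
    intro p hp
    -- `I` is radical since `R` is reduced, so `C` being closed says that `I` is the ideal of `V`.
    have hrad : I.radical = I := by
      refine le_antisymm (fun p ⟨n, hn⟩ => ?_) Ideal.le_radical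
      exact IsNilpotent.eq_zero ⟨n, (map_pow θ p n).symm.trans hn⟩
    have h := hC.2 1 I hI
    rw [← hrad]
    refine h.symm ▸ fun a ha => ?_
    have := hp ⟨a, ha⟩
    rw [hev] at this
    exact (map_eq_zero_iff _ hinj).1 this
  -- `B` is isomorphic to the subring of `R` generated over `C` by the `K`-orbit of `c`. Both `R` and
  -- the power `V → L` contain it as a ring of constants, hence contain `L ⊗ B`.
  let B := P ⧸ I
  have : Module.Flat C B := hC.1.1 B
  let β : B →ₐ[C] R := Ideal.kerLiftAlg θ
  have hβ : Function.Injective β := Ideal.kerLiftAlg_injective θ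
  let βV : B →ₐ[C] (V → L) := Ideal.Quotient.liftₐ I (AlgHom.pi ev) (by
    intro p hp
    ext a
    change ev a p = 0
    exact (hev a p).trans ((congrArg _ (a.2 p hp)).trans (map_zero _)))
  let F : L ⊗[C] B →ₐ[L] R := Algebra.TensorProduct.lift (Algebra.ofId L R) β
    fun _ _ => Commute.all _ _
  let FV : L ⊗[C] B →ₐ[L] (V → L) := Algebra.TensorProduct.lift (Algebra.ofId L (V → L)) βV
    fun _ _ => Commute.all _ _
  have hF1 : ∀ b, F (1 ⊗ₜ b) = β b := fun b => by simp [F]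
  have hFV1 : ∀ b, FV (1 ⊗ₜ b) = βV b := fun b => by simp [FV]
  have hF : Function.Injective F := by
    refine injective_of_invariant hL hσ hCH B (fun h => DistribSMul.toAddMonoidHom R h) ?_
      F.toLinearMap ?_ ?_
    · intro h l m
      change h • (l • m) = (h • l) • h • m
      rw [Algebra.smul_def, Algebra.smul_def, smul_mul']
      exact congrArg (· * h • m) (hLR h l).symm
    · intro h b
      obtain ⟨p, rfl⟩ := Ideal.Quotient.mk_surjective b
      change h • F (1 ⊗ₜ _) = F (1 ⊗ₜ _)
      rw [hF1]
      change h • θ p = θ p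
      induction p using MvPolynomial.induction_on with
      | C a =>
        change h • θ (algebraMap C P a) = θ (algebraMap C P a)
        rw [AlgHom.commutes, hCHR]
      | add p q hp hq => rw [map_add, smul_add, hp, hq]
      | mul_X p i hp =>
        rw [map_mul, smul_mul', hp, MvPolynomial.aeval_X]
        have : h • (i.1 : G) • c = (i.1 : G) • c :=
          (smul_comm (h : G) (i.1 : G) c).trans (congrArg _ (hc h))
        rw [this]
    · intro b hb
      exact hβ (((hF1 b).symm.trans hb).trans (map_zero β).symm)
  have hFV : Function.Injective FV := by
    refine injective_of_invariant hL hσ hCH B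
      (fun h => (DistribSMul.toAddMonoidHom L h).compLeft V) ?_ FV.toLinearMap ?_ ?_
    · intro h l m
      ext a
      exact smul_mul' h l (m a)
    · intro h b
      obtain ⟨p, rfl⟩ := Ideal.Quotient.mk_surjective b
      ext a
      change h • FV (1 ⊗ₜ _) a = FV (1 ⊗ₜ _) a
      rw [hFV1]
      change h • ev a p = ev a p
      rw [hev]
      exact (hCH _).2 ⟨_, rfl⟩ h
    · intro b hb
      obtain ⟨p, rfl⟩ := Ideal.Quotient.mk_surjective b
      refine Ideal.Quotient.eq_zero_iff_mem.2 (hVI p fun a => ?_)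
      exact congrFun ((hFV1 _).symm.trans hb) a
  have : Algebra.FiniteType C B :=
    .of_surjective (Ideal.Quotient.mkₐ C I) (Ideal.Quotient.mkₐ_surjective C I)
  obtain ⟨a, r, hr, hrF⟩ := exists_prime_of_injective F hF FV hFV
  -- Each `k • (c - a)` vanishes at the point `a`, so these elements all lie in the prime `r`.
  refine ⟨a.1 0, ?_⟩
  have hk : ∀ k ∈ K, k • (c - algebraMap C R (a.1 0)) ∈ r := by
    intro k hkK
    let q : P := MvPolynomial.X (⟨k, hkK⟩, 0) - MvPolynomial.C ((⟨k, hkK⟩ : K) • a.1 0)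
    have h1 : F (1 ⊗ₜ Ideal.Quotient.mk I q) = k • (c - algebraMap C R (a.1 0)) := by
      rw [hF1]
      change θ q = _
      rw [map_sub, smul_sub, MvPolynomial.aeval_X, ← hCKR ⟨k, hkK⟩]
      exact congrArg (_ - ·) (MvPolynomial.aeval_C _ _)
    rw [← h1]
    refine hrF _ ?_
    rw [hFV1]
    change ev a q = 0
    rw [map_sub, MvPolynomial.aeval_X, sub_eq_zero]
    exact (MvPolynomial.aeval_C _ _).symm
  let J : Ideal R := Ideal.span (Set.range fun g : G => g • (c - algebraMap C R (a.1 0)))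
  have hJr : J ≤ r := by
    rw [Ideal.span_le]
    rintro _ ⟨g, rfl⟩
    obtain ⟨h, hh, k, hkK, rfl⟩ := hHK g
    have : h • (c - algebraMap C R (a.1 0)) = c - algebraMap C R (a.1 0) := by
      rw [smul_sub]
      exact congrArg₂ _ (hc ⟨h, hh⟩) (hCHR ⟨h, hh⟩ _)
    change (h * k) • _ ∈ r
    rw [mul_comm, mul_smul, this]
    exact hk k hkK
  have hJ : IsDifferenceIdeal G J := by
    intro g x hx
    induction hx using Submodule.span_induction with
    | mem y hy =>
      obtain ⟨g', rfl⟩ := hy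
      exact Ideal.subset_span ⟨g * g', mul_smul _ _ _⟩
    | zero => rw [smul_zero]; exact zero_mem _
    | add y z _ _ hy hz => rw [smul_add]; exact add_mem hy hz
    | smul l y _ hy => rw [smul_eq_mul, smul_mul']; exact J.mul_mem_left _ hy
  have hJ0 : J = ⊥ := (hR.2 J hJ).resolve_right fun h => hr.ne_top (top_le_iff.1 (h ▸ hJr))
  have h0 : c - algebraMap C R (a.1 0) ∈ J := Ideal.subset_span ⟨1, one_smul _ _⟩
  rw [hJ0, Ideal.mem_bot, sub_eq_zero] at h0
  exact h0.symm

end DifferenceAlgebra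

theorem mainTheorem6 {s : ℕ} (t : Fin s → ℕ) (ht : ∀ i, 2 ≤ t i)
    (L : Type u) [CommRing L] [MulSemiringAction (Sig t) L]
    (hLnoeth : IsNoetherianRing L)
    (hL : IsPseudofield (Sig t) L)
    (hC : IsClosedPseudofield (Sig1 t) (SigmaConstants t L))
    (R : Type v) [CommRing R] [MulSemiringAction (Sig t) R] [Algebra L R]
    (hLR : ∀ (τ : Sig t) (l : L), algebraMap L R (τ • l) = τ • algebraMap L R l)
    (hfg : IsDifferenceFinitelyGenerated (Sig1 t) L R)
    (hR : IsDifferenceSimple (Sig t) R) :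
    SigmaConstants t R = (SigmaConstants t L).map (algebraMap L R) := by
  have : ∀ i, NeZero (t i) := fun i => ⟨by have := ht i; omega⟩
  have hfin : Finite (Sig1 t) := by
    refine Finite.of_injective
      (fun k : Sig1 t => (Multiplicative.toAdd (k : Sig t)).2) fun k k' hkk' => ?_
    have hk := k.2.1
    have hk' := k'.2.1
    exact Subtype.ext (Prod.ext (hk.trans hk'.symm) hkk')
  have hdecomp : ∀ g : Sig t, ∃ h ∈ Sig0 t, ∃ k ∈ Sig1 t, g = h * k := by
    intro g
    refine ⟨Multiplicative.ofAdd (g.toAdd.1, 0), ⟨g.toAdd.1, ?_⟩,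
      Multiplicative.ofAdd (0, g.toAdd.2), ⟨rfl, trivial⟩, ?_⟩
    · change Multiplicative.ofAdd (1, 0) ^ _ = _
      rw [← ofAdd_zsmul]
      simp
    · rw [← ofAdd_add]
      simp
  have hft : Algebra.FiniteType L R := by
    obtain ⟨S, hS⟩ := hfg
    refine ⟨⟨Set.Finite.toFinset (s := {x : R | ∃ g : Sig1 t, ∃ a ∈ S, x = g • a}) ?_, ?_⟩⟩
    · refine ((Set.finite_univ (α := Sig1 t)).image2 (· • ·) S.finite_toSet).subset ?_
      rintro _ ⟨g, a, ha, rfl⟩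
      exact ⟨g, trivial, a, ha, rfl⟩
    · rw [Set.Finite.coe_toFinset, hS]
  apply le_antisymm
  · intro c hc
    obtain ⟨a, ha⟩ := mem_range_of_invariant (Sig0 t) (Sig1 t) hdecomp
      (σ := ⟨Multiplicative.ofAdd (1, 0), Subgroup.mem_zpowers _⟩)
      (by
        rintro ⟨h, n, rfl⟩
        exact ⟨n, Subtype.ext rfl⟩)
      hL.1 (C := SigmaConstants t L) Subtype.val_injective (fun _ _ => rfl)
      (fun l => ⟨fun hl => ⟨⟨l, hl⟩, rfl⟩, by rintro ⟨a, rfl⟩; exact a.2⟩) hC hLR hR hc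
    exact ⟨a, a.2, ha⟩
  · rintro _ ⟨a, ha, rfl⟩ h
    exact (hLR h a).symm.trans (congrArg _ (ha h))
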